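/- **Theorem (Galois theory of real covering spaces).** A *real structure* on a Riemann surface is an anti-holomorphic involution. Let $X$ be a connected Riemann surface (Hausdorff, without boundary), let $\sigma$ be a real structure on $X$, and let $x\in X$; the pair $(X,\sigma)$ is called a connected Klein surface. Fix a universal cover $p:(\widetilde X,\widetilde x)\to (X,x)$, that is, a pointed covering map with $\widetilde X$ simply connected. Let $$\pi_1^{\mathbb R}((X,\sigma);x)=\{f:\widetilde X\to\widetilde X \text{ a homeomorphism}\;:\; p\circ f=\sigma_f\circ p\ \text{ for some }\ \sigma_f\in\{\mathrm{Id}_X,\sigma\}\}^{\mathrm{op}},$$ with product $f\cdot g:=g\circ f$, and let $\pi_1(X;x)$ be its normal subgroup $\{f:\sigma_f=\mathrm{Id}_X\}$. The group $\pi_1^{\mathbb R}((X,\sigma);x)$ acts on $\widetilde X$ on the right by $z\cdot f:=f(z)$. A *real cover* of $(X,\sigma)$ is a Hausdorff Riemann surface $Y$ (possibly disconnected or empty) with a real structure $\tau$ and a holomorphic topological covering map $q:Y\to X$ such that $q\circ\tau=\sigma\circ q$. A homomorphism $(Y,\tau,q)\to(Y',\tau',q')$ of real covers is a holomorphic map $\phi:Y\to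 Y'$ with $q'\circ\phi=q$ and $\phi\circ\tau=\tau'\circ\phi$. For $y\in q^{-1}(\{x\})$ let $t_y:\widetilde X\to Y$ be the unique continuous map with $q\circ t_y=p$ and $t_y(\widetilde x)=y$. Then $\pi_1^{\mathbb R}((X,\sigma);x)$ acts on the left on $q^{-1}(\{x\})$ by $f\cdot y:=\tau_f^{-1}(t_y(f(\widetilde x)))$, where $\tau_f=\mathrm{Id}_Y$ if $\sigma_f=\mathrm{Id}_X$ and $\tau_f=\tau$ if $\sigma_f=\sigma$. There is an element $h\in\pi_1^{\mathbb R}((X,\sigma);x)$ with $\sigma_h=\sigma$, and the fibre-at-$x$ functor $$(Y,\tau,q)\longmapsto q^{-1}(\{x\})$$ is an equivalence from the category of real covers of $(X,\sigma)$ to the category of (discrete) left $\pi_1^{\mathbb R}((X,\sigma);x)$-sets. A quasi-inverse is the functor $$F\longmapsto \widetilde X\times_{\pi_1(X;x)}F:=(\widetilde X\times F)\big/\big((z,v)\sim(z\cdot f^{-1},f\cdot v),\ f\in\pi_1(X;x)\big),$$ where the right side has the quotient topology ($F$ being discrete), the covering map $[z,v]\mapsto p(z)$ to $X$ with the complex structure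 that makes it holomorphic, and the real structure $[z,v]\mapsto[z\cdot h^{-1},h\cdot v]$, which is the same for every $h$ with $\sigma_h=\sigma$; a map $g:F\to F'$ of $\pi_1^{\mathbb R}((X,\sigma);x)$-sets is sent to $[z,v]\mapsto[z,g(v)]$. -/

import Mathlib

open CategoryTheory
open scoped Manifold ContDiff ComplexConjugate

universe u

namespace KleinSurface

/-- A map between Riemann surfaces (charted on `ℂ`) is anti-holomorphic if it is continuous and,
read in the charts at each point, real-differentiable there with `ℂ`-antilinear derivative. -/
def AntiHolomorphic {X Y : Type*} [TopologicalSpace X] [ChartedSpace ℂ X]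
    [TopologicalSpace Y] [ChartedSpace ℂ Y] (f : X → Y) : Prop :=
  Continuous f ∧ ∀ x : X, ∃ L : ℂ →L[ℝ] ℂ,
    HasFDerivAt (fun z => chartAt ℂ (f x) (f ((chartAt ℂ x).symm z))) L (chartAt ℂ x x) ∧
    ∀ c v : ℂ, L (c * v) = conj c * L v

/-- A real structure on a Riemann surface: an anti-holomorphic involution. -/
structure RealStructure (X : Type*) [TopologicalSpace X] [ChartedSpace ℂ X] where
  toFun : X → X
  antiHolomorphic : AntiHolomorphic toFun
  involutive : Function.Involutive toFun

instance {X : Type*} [TopologicalSpace X] [ChartedSpace ℂ X] :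
    CoeFun (RealStructure X) (fun _ => X → X) := ⟨RealStructure.toFun⟩

section Covers

variable {X : Type u} [TopologicalSpace X] [ChartedSpace ℂ X]

/-- A real cover `q : (Y, τ) ⟶ (X, σ)`: a Hausdorff Riemann surface `Y`, not necessarily connected,
with a real structure `τ` and a holomorphic covering map `q` such that `q ∘ τ = σ ∘ q`. -/
structure RealCover (σ : RealStructure X) where
  carrier : Type u
  [topologicalSpace : TopologicalSpace carrier]
  [t2Space : T2Space carrier]
  [chartedSpace : ChartedSpace ℂ carrier]
  [isManifold : IsManifold 𝓘(ℂ, ℂ) ω carrier]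
  tau : RealStructure carrier
  proj : carrier → X
  holomorphic : MDifferentiable 𝓘(ℂ, ℂ) 𝓘(ℂ, ℂ) proj
  isCoveringMap : IsCoveringMap proj
  proj_tau : ∀ y, proj (tau y) = σ (proj y)

attribute [instance] RealCover.topologicalSpace RealCover.t2Space RealCover.chartedSpace
  RealCover.isManifold

variable {σ : RealStructure X}

/-- A homomorphism of real covers: a holomorphic map over `X` commuting with the real structures. -/
@[ext]
structure RealCover.Hom (Y Z : RealCover σ) where
  toFun : Y.carrier → Z.carrier
  holomorphic : MDifferentiable 𝓘(ℂ, ℂ) 𝓘(ℂ, ℂ) toFun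
  map_tau : ∀ y, toFun (Y.tau y) = Z.tau (toFun y)
  proj_map : ∀ y, Z.proj (toFun y) = Y.proj y

/-- The category of real covers of `(X, σ)`. -/
instance : Category (RealCover σ) where
  Hom := RealCover.Hom
  id Y := ⟨id, mdifferentiable_id, fun _ => rfl, fun _ => rfl⟩
  comp f g := ⟨g.toFun ∘ f.toFun, g.holomorphic.comp f.holomorphic,
    fun y => by simp [f.map_tau, g.map_tau], fun y => by simp [f.proj_map, g.proj_map]⟩

end Covers

/-- A (pointed) universal cover `p : (X̃, x̃) ⟶ (X, x)`: a covering map with simply connected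
total space. -/
structure UniversalCover {X : Type u} [TopologicalSpace X] (x : X) where
  carrier : Type u
  [topologicalSpace : TopologicalSpace carrier]
  [simplyConnectedSpace : SimplyConnectedSpace carrier]
  proj : carrier → X
  isCoveringMap : IsCoveringMap proj
  base : carrier
  proj_base : proj base = x

attribute [instance] UniversalCover.topologicalSpace UniversalCover.simplyConnectedSpace

section FundamentalGroup

variable {X : Type u} [TopologicalSpace X] [ChartedSpace ℂ X] (σ : RealStructure X) {x : X}
  (U : UniversalCover x)

/-- The group, under composition, of self-homeomorphisms `f` of `X̃` with `p ∘ f = p` or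
`p ∘ f = σ ∘ p`. -/
def realAut : Subgroup (U.carrier ≃ₜ U.carrier) where
  carrier := {f | (∀ z, U.proj (f z) = U.proj z) ∨ (∀ z, U.proj (f z) = σ (U.proj z))}
  one_mem' := Or.inl fun _ => rfl
  mul_mem' := by
    rintro f g (hf | hf) (hg | hg)
    · exact Or.inl fun z => (hf (g z)).trans (hg z)
    · exact Or.inr fun z => (hf (g z)).trans (hg z)
    · exact Or.inr fun z => (hf (g z)).trans (congrArg σ (hg z))
    · exact Or.inl fun z =>
        ((hf (g z)).trans (congrArg σ (hg z))).trans (σ.involutive _)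
  inv_mem' := by
    rintro f (hf | hf)
    · refine Or.inl fun z => ?_
      have h := hf (f.symm z)
      rw [f.apply_symm_apply] at h
      exact h.symm
    · refine Or.inr fun z => ?_
      have h := hf (f.symm z)
      rw [f.apply_symm_apply] at h
      rw [h]
      exact (σ.involutive _).symm

/-- The fundamental group `π₁^ℝ((X, σ); x)` of `(X, σ)`: the opposite of `realAut`, so that the
product `f * g` is the composite `g ∘ f`. -/
abbrev RealPi1 := (realAut σ U)ᵐᵒᵖ

variable {σ U}

/-- The self-homeomorphism of `X̃` underlying an element of `π₁^ℝ((X, σ); x)`; `g.homeo z` is the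
right action of `g` on `z`. -/
def RealPi1.homeo (g : RealPi1 σ U) : U.carrier ≃ₜ U.carrier := g.unop.1

/-- `g` covers the identity of `X`, that is, it has trivial class in `ℤ/2ℤ`. -/
def RealPi1.CoversId (g : RealPi1 σ U) : Prop := ∀ z, U.proj (g.homeo z) = U.proj z

/-- `g` covers the real structure of `X`, that is, it has nontrivial class in `ℤ/2ℤ`. -/
def RealPi1.CoversSigma (g : RealPi1 σ U) : Prop := ∀ z, U.proj (g.homeo z) = σ (U.proj z)

lemma RealPi1.coversId_or (g : RealPi1 σ U) : g.CoversId ∨ g.CoversSigma := g.unop.2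

variable (σ U) in
/-- The topological fundamental group `π₁(X; x)`, as the subgroup of the elements of
`π₁^ℝ((X, σ); x)` that cover the identity of `X`. -/
def pi1 : Subgroup (RealPi1 σ U) where
  carrier := {g | g.CoversId}
  one_mem' := fun _ => rfl
  mul_mem' := by
    intro f g hf hg z
    exact (hg (f.homeo z)).trans (hf z)
  inv_mem' := by
    intro f hf z
    have h := hf (f.homeo.symm z)
    rw [f.homeo.apply_symm_apply] at h
    exact h.symm

end FundamentalGroup

section Fibre

variable {X : Type u} [TopologicalSpace X] [ChartedSpace ℂ X] {σ : RealStructure X} {x : X}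

lemma UniversalCover.locallyPathConnectedSpace (U : UniversalCover x) :
    LocallyPathConnectedSpace U.carrier := by
  have : LocallyPathConnectedSpace X := ChartedSpace.locallyPathConnectedSpace ℂ X
  choose e he _ using U.isCoveringMap.isLocalHomeomorph
  let _ : ChartedSpace X U.carrier :=
    { atlas := Set.range e
      chartAt := e
      mem_chart_source := he
      chart_mem_atlas := fun z => ⟨z, rfl⟩ }
  exact ChartedSpace.locallyPathConnectedSpace X U.carrier

/-- The fibre at `x` of a real cover. -/
def RealCover.Fibre (Y : RealCover σ) (x : X) : Type u := {y : Y.carrier // Y.proj y = x}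

lemma RealCover.existsUnique_lift (Y : RealCover σ) (U : UniversalCover x) (y : Y.Fibre x) :
    ∃! t : C(U.carrier, Y.carrier), t U.base = y.1 ∧ Y.proj ∘ t = U.proj := by
  have := U.locallyPathConnectedSpace
  exact Y.isCoveringMap.existsUnique_continuousMap_lifts
    ⟨U.proj, U.isCoveringMap.continuous⟩ U.base y.1 (y.2.trans U.proj_base.symm)

/-- The unique map `t_y : X̃ ⟶ Y` over `X` sending `x̃` to `y`. -/
noncomputable def RealCover.lift (Y : RealCover σ) (U : UniversalCover x) (y : Y.Fibre x) :
    C(U.carrier, Y.carrier) := (Y.existsUnique_lift U y).choose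

lemma RealCover.lift_base (Y : RealCover σ) (U : UniversalCover x) (y : Y.Fibre x) :
    Y.lift U y U.base = y.1 := (Y.existsUnique_lift U y).choose_spec.1.1

lemma RealCover.proj_lift (Y : RealCover σ) (U : UniversalCover x) (y : Y.Fibre x)
    (z : U.carrier) : Y.proj (Y.lift U y z) = U.proj z :=
  congrFun (Y.existsUnique_lift U y).choose_spec.1.2 z

lemma RealCover.eq_lift (Y : RealCover σ) (U : UniversalCover x) (y : Y.Fibre x)
    {t : U.carrier → Y.carrier} (ht : Continuous t) (h0 : t U.base = y.1)
    (h : ∀ z, Y.proj (t z) = U.proj z) : t = Y.lift U y :=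
  congrArg DFunLike.coe
    ((Y.existsUnique_lift U y).choose_spec.2 ⟨t, ht⟩ ⟨h0, funext h⟩)

variable {U : UniversalCover x}

open Classical in
/-- The map `τ_g` of `Y`: the identity if `g` covers the identity of `X`, and `τ` otherwise. -/
noncomputable def RealCover.tauOf (Y : RealCover σ) (g : RealPi1 σ U) : Y.carrier → Y.carrier :=
  if g.CoversId then id else Y.tau

lemma RealCover.continuous_tauOf (Y : RealCover σ) (g : RealPi1 σ U) :
    Continuous (Y.tauOf g) := by
  unfold RealCover.tauOf
  split_ifs
  · exact continuous_id
  · exact Y.tau.antiHolomorphic.1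

lemma RealCover.tauOf_tauOf (Y : RealCover σ) (g : RealPi1 σ U) (y : Y.carrier) :
    Y.tauOf g (Y.tauOf g y) = y := by
  unfold RealCover.tauOf
  split_ifs
  · rfl
  · exact Y.tau.involutive y

lemma RealCover.proj_tauOf (Y : RealCover σ) (g : RealPi1 σ U) {y : Y.carrier} {z : U.carrier}
    (h : Y.proj y = U.proj (g.homeo z)) : Y.proj (Y.tauOf g y) = U.proj z := by
  unfold RealCover.tauOf
  split_ifs with hg
  · exact h.trans (hg z)
  · have hs := g.coversId_or.resolve_left hg
    rw [Y.proj_tau, h, hs z]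
    exact σ.involutive _

lemma RealCover.tauOf_mul (Y : RealCover σ) (f g : RealPi1 σ U) (y : Y.carrier) :
    Y.tauOf (f * g) y = Y.tauOf f (Y.tauOf g y) := by
  have key : ∀ z, (f * g).homeo z = g.homeo (f.homeo z) := fun _ => rfl
  unfold RealCover.tauOf
  by_cases hf : f.CoversId <;> by_cases hg : g.CoversId
  · have : (f * g).CoversId := (pi1 σ U).mul_mem hf hg
    simp [hf, hg, this]
  · have : ¬ (f * g).CoversId := fun h => hg <| by
      have := (pi1 σ U).mul_mem ((pi1 σ U).inv_mem hf) h
      rwa [inv_mul_cancel_left] at this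
    simp [hf, hg, this]
  · have : ¬ (f * g).CoversId := fun h => hf <| by
      have := (pi1 σ U).mul_mem h ((pi1 σ U).inv_mem hg)
      rwa [mul_inv_cancel_right] at this
    simp [hf, hg, this]
  · have hf' := f.coversId_or.resolve_left hf
    have hg' := g.coversId_or.resolve_left hg
    have : (f * g).CoversId := fun z => by
      rw [key, hg', hf']
      exact σ.involutive _
    simp [hf, hg, this, Y.tau.involutive y]

/-- The left action of `π₁^ℝ((X, σ); x)` on the fibre at `x` of a real cover:
`g • y = τ_g⁻¹ (t_y (g x̃))`, where `τ_g⁻¹ = τ_g`. -/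
noncomputable instance RealCover.fibreAction (Y : RealCover σ) :
    MulAction (RealPi1 σ U) (Y.Fibre x) where
  smul g y := ⟨Y.tauOf g (Y.lift U y (g.homeo U.base)), by
    rw [Y.proj_tauOf g (Y.proj_lift U y _), U.proj_base]⟩
  one_smul y := by
    apply Subtype.ext
    have h1 : (1 : RealPi1 σ U).CoversId := (pi1 σ U).one_mem
    change Y.tauOf (1 : RealPi1 σ U) (Y.lift U y ((1 : RealPi1 σ U).homeo U.base)) = y.1
    simp only [RealCover.tauOf, h1, if_true, id]
    exact Y.lift_base U y
  mul_smul f g y := by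
    apply Subtype.ext
    change Y.tauOf (f * g) (Y.lift U y (g.homeo (f.homeo U.base))) =
      Y.tauOf f (Y.lift U _ (f.homeo U.base))
    rw [Y.tauOf_mul]
    congr 1
    refine congrFun (Y.eq_lift U _ (t := fun z => Y.tauOf g (Y.lift U y (g.homeo z))) ?_ rfl ?_)
      (f.homeo U.base)
    · exact (Y.continuous_tauOf g).comp ((Y.lift U y).continuous.comp g.homeo.continuous)
    · exact fun z => Y.proj_tauOf g (Y.proj_lift U y _)

/-- The map induced on fibres by a homomorphism of real covers. -/
def RealCover.Hom.fibreMap {Y Z : RealCover σ} (φ : Y ⟶ Z) (x : X) (y : Y.Fibre x) : Z.Fibre x :=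
  ⟨RealCover.Hom.toFun φ y.1, (RealCover.Hom.proj_map φ y.1).trans y.2⟩

lemma RealCover.Hom.fibreMap_smul {Y Z : RealCover σ} (φ : Y ⟶ Z) (g : RealPi1 σ U)
    (y : Y.Fibre x) :
    RealCover.Hom.fibreMap φ x (g • y) = g • RealCover.Hom.fibreMap φ x y := by
  apply Subtype.ext
  change RealCover.Hom.toFun φ (Y.tauOf g (Y.lift U y (g.homeo U.base))) =
    Z.tauOf g (Z.lift U (RealCover.Hom.fibreMap φ x y) (g.homeo U.base))
  have h : (fun z => RealCover.Hom.toFun φ (Y.lift U y z)) =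
      Z.lift U (RealCover.Hom.fibreMap φ x y) := by
    refine Z.eq_lift U _ ?_ ?_ ?_
    · exact (RealCover.Hom.holomorphic φ).continuous.comp (Y.lift U y).continuous
    · exact congrArg _ (Y.lift_base U y)
    · exact fun z => (RealCover.Hom.proj_map φ _).trans (Y.proj_lift U y z)
  rw [← h]
  unfold RealCover.tauOf
  split_ifs
  · rfl
  · exact RealCover.Hom.map_tau φ _

variable (σ U) in
/-- The fibre-at-`x` functor from real covers of `(X, σ)` to left `π₁^ℝ((X, σ); x)`-sets. -/
noncomputable def fibreFunctor : RealCover σ ⥤ Action (Type u) (RealPi1 σ U) where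
  obj Y := Action.ofMulAction (RealPi1 σ U) (Y.Fibre x)
  map φ :=
    { hom := ↾(RealCover.Hom.fibreMap φ x)
      comm := fun g => by
        ext y
        exact RealCover.Hom.fibreMap_smul φ g y }
  map_id _ := rfl
  map_comp _ _ := rfl

end Fibre

section BalancedProduct

variable {X : Type u} [TopologicalSpace X] [ChartedSpace ℂ X] {σ : RealStructure X} {x : X}
  {U : UniversalCover x} (F : Action (Type u) (RealPi1 σ U))

/-- The orbit relation on `X̃ × F` of the left action `f • (z, v) = (z · f⁻¹, f • v)` of
`π₁(X; x)`, where `z · f = f z` is the right action on `X̃`. -/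
def balancedSetoid : Setoid (U.carrier × F.V) where
  r a b := ∃ f ∈ pi1 σ U, b = (f⁻¹.homeo a.1, F.ρ f a.2)
  iseqv :=
    { refl := fun a => ⟨1, (pi1 σ U).one_mem, by
        rw [map_one]
        rfl⟩
      symm := by
        rintro ⟨z, v⟩ _ ⟨f, hf, rfl⟩
        refine ⟨f⁻¹, (pi1 σ U).inv_mem hf, ?_⟩
        refine Prod.ext ?_ ?_
        · exact (f.homeo.apply_symm_apply z).symm
        · change v = (F.ρ f⁻¹ * F.ρ f) v
          rw [← map_mul, inv_mul_cancel, map_one]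
          rfl
      trans := by
        rintro ⟨z, v⟩ _ _ ⟨f, hf, rfl⟩ ⟨g, hg, rfl⟩
        refine ⟨g * f, (pi1 σ U).mul_mem hg hf, ?_⟩
        refine Prod.ext ?_ ?_
        · rw [mul_inv_rev]
          rfl
        · rw [map_mul]
          rfl }

/-- The space `X̃ ×_{π₁(X; x)} F`. -/
def BalancedProduct : Type u := Quotient (balancedSetoid F)

/-- The quotient topology of the product topology on `X̃ × F`, for the discrete topology on `F`. -/
instance : TopologicalSpace (BalancedProduct F) :=
  letI : TopologicalSpace F.V := ⊥
  inferInstanceAs (TopologicalSpace (Quotient (balancedSetoid F)))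

/-- The class `[z, v]` in `X̃ ×_{π₁(X; x)} F`. -/
def BalancedProduct.mk (z : U.carrier) (v : F.V) : BalancedProduct F :=
  Quotient.mk (balancedSetoid F) (z, v)

end BalancedProduct

end KleinSurface

/-! The argument is classical covering theory, carried out with the extended group. Since `X̃` is
simply connected and locally path connected, continuous maps out of it lift through coverings,
uniquely once one value is given. Hence `π₁(X; x)` acts freely and transitively on the fibres of
`p`, and `σ` itself lifts to some `h`.

Freeness and transitivity show that a local section `s` of `p` trivialises `X̃ ×_{π₁} F` by `(w, v)
↦ [s w, v]` (`isCoveringMap_proj`). Two lifts of `σ` differ by an element of `π₁`, so the involution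
`[z, v] ↦ [z · h⁻¹, h • v]` is well defined and independent of `h` (`mk_act_eq`).

The two natural isomorphisms are `v ↦ [x̃, v]` and `[z, y] ↦ t_y z`. Compatibility with all the
structure reduces to the identity `t_{g • y}(z · g⁻¹) = τ_g (t_y z)` (`lift_smul_inv`) and to the
formula `t_{[x̃, v]} z = [z, v]` (`lift_fibrePoint`).

The complex structure adds no condition. Charts of `X` pull back along a local homeomorphism, lifts
of `σ` are then anti-holomorphic, and every continuous map over `X` between holomorphic coverings is
holomorphic because a holomorphic local homeomorphism has holomorphic local inverses. -/

open Filter Topology Set in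
/-- The inverse of an injective holomorphic function is holomorphic. -/
theorem OpenPartialHomeomorph.differentiableOn_symm (e : OpenPartialHomeomorph ℂ ℂ)
    (he : DifferentiableOn ℂ e e.source) : DifferentiableOn ℂ e.symm e.target := by
  intro w hw
  have hz : e.symm w ∈ e.source := e.map_target hw
  have hsrc : e.source ∈ 𝓝 (e.symm w) := e.open_source.mem_nhds hz
  have han : AnalyticAt ℂ (deriv e) (e.symm w) :=
    (he.deriv e.open_source).analyticAt hsrc
  rcases han.eventually_eq_zero_or_eventually_ne_zero with h | h
  -- If `deriv e` vanishes near the point, `e` is constant on a ball, contradicting injectivity.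
  · exfalso
    obtain ⟨r, hr, hball⟩ := Metric.mem_nhds_iff.1 (Filter.inter_mem hsrc h)
    have hdiff : DifferentiableOn ℂ e (Metric.ball (e.symm w) r) :=
      he.mono fun y hy => (hball hy).1
    have hmem : e.symm w + (r / 2 : ℝ) ∈ Metric.ball (e.symm w) r := by
      rw [Metric.mem_ball, dist_eq_norm, add_sub_cancel_left, Complex.norm_real,
        Real.norm_of_nonneg (by positivity)]
      linarith
    have hconst := Metric.isOpen_ball.is_const_of_deriv_eq_zero
      (convex_ball _ _).isPreconnected hdiff (fun y hy => (hball hy).2)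
      hmem (Metric.mem_ball_self hr)
    have := e.injOn (hball hmem).1 hz hconst
    simp at this
    exact hr.ne' this
  · have hc := e.continuousAt_symm hw
    have hinj : ∀ᶠ w' in 𝓝[≠] w, w' ∈ e.target ∧ e.symm w' ≠ e.symm w := by
      filter_upwards [self_mem_nhdsWithin,
        mem_nhdsWithin_of_mem_nhds (e.open_target.mem_nhds hw)] with w' hne hw'
      exact ⟨hw', fun hh => hne (e.symm.injOn hw' hw hh)⟩
    have htend : Tendsto e.symm (𝓝[≠] w) (𝓝[≠] (e.symm w)) :=
      tendsto_nhdsWithin_iff.2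
        ⟨hc.tendsto.mono_left nhdsWithin_le_nhds, hinj.mono fun _ hh => hh.2⟩
    -- Zeros of `deriv e` are now isolated, so `e.symm` is differentiable on a punctured
    -- neighbourhood of `w`; continuity at `w` makes the singularity removable.
    refine (Complex.analyticAt_of_differentiable_on_punctured_nhds_of_continuousAt
      ?_ hc).differentiableAt.differentiableWithinAt
    filter_upwards [hinj, htend.eventually h] with w' hw' hd
    exact (e.hasDerivAt_symm hw'.1 hd
      (he.differentiableAt (e.open_source.mem_nhds (e.map_target hw'.1))).hasDerivAt).differentiableAt

/-- A space separated over a Hausdorff space is Hausdorff. -/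
theorem IsSeparatedMap.t2Space {B X : Type*} [TopologicalSpace B] [TopologicalSpace X] [T2Space X]
    {p : B → X} (hp : IsSeparatedMap p) (hc : Continuous p) : T2Space B where
  t2 a b hab := by
    by_cases h : p a = p b
    · exact hp a b h hab
    · exact separated_by_continuous hc h

/-! ### Pulling back charts along a local homeomorphism -/

namespace IsLocalHomeomorph

variable {B X H : Type*} [TopologicalSpace B] [TopologicalSpace X] [TopologicalSpace H]
  [ChartedSpace H X] {p : B → X}

/-- The charts of the source of a local homeomorphism obtained by restricting it to a small open set
and composing with the charts of the target. -/
@[reducible] noncomputable def pullbackChartedSpace (hp : IsLocalHomeomorph p) :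
    ChartedSpace H B where
  atlas := Set.range fun b => (hp b).choose ≫ₕ chartAt H (p b)
  chartAt b := (hp b).choose ≫ₕ chartAt H (p b)
  mem_chart_source b := by
    have h := (hp b).choose_spec
    refine ⟨h.1, ?_⟩
    change (hp b).choose b ∈ (chartAt H (p b)).source
    rw [← h.2]
    exact mem_chart_source H (p b)
  chart_mem_atlas b := ⟨b, rfl⟩

/-- Both local pieces `e` and `e'` are restrictions of the same map `p`, so `e' ∘ e.symm` is the
identity where defined. A transition map upstairs is therefore a restriction of one downstairs. -/
theorem pullbackChartedSpace_hasGroupoid (hp : IsLocalHomeomorph p) (G : StructureGroupoid H)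
    [HasGroupoid X G] [ClosedUnderRestriction G] :
    letI : ChartedSpace H B := hp.pullbackChartedSpace
    HasGroupoid B G := by
  let : ChartedSpace H B := hp.pullbackChartedSpace
  refine ⟨?_⟩
  rintro _ _ ⟨a, rfl⟩ ⟨b, rfl⟩
  obtain ⟨ha, hpa⟩ := (hp a).choose_spec
  obtain ⟨hb, hpb⟩ := (hp b).choose_spec
  dsimp only
  generalize (hp a).choose = e at *
  generalize (hp b).choose = e' at *
  have hG : (chartAt H (p a)).symm ≫ₕ chartAt H (p b) ∈ G :=
    G.compatible (chart_mem_atlas H _) (chart_mem_atlas H _)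
  have key : ∀ y ∈ e.target, e' (e.symm y) = y := fun y hy => by
    rw [← congrFun hpb, congrFun hpa]
    exact e.right_inv hy
  have hopen := ((e ≫ₕ chartAt H (p a)).symm ≫ₕ e' ≫ₕ chartAt H (p b)).open_source
  refine G.mem_of_eqOnSource (closedUnderRestriction' hG hopen) ⟨?_, ?_⟩
  · rw [OpenPartialHomeomorph.restr_source' _ _ hopen]
    refine (Set.inter_eq_right.2 ?_).symm
    rintro w ⟨⟨hw1, hw2⟩, hw3, hw4⟩
    refine ⟨hw1, ?_⟩
    have h4 : e' (e.symm ((chartAt H (p a)).symm w)) ∈ (chartAt H (p b)).source := hw4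
    rw [key _ hw2] at h4
    exact h4
  · rintro w ⟨⟨hw1, hw2⟩, hw3, hw4⟩
    exact congrArg (chartAt H (p b)) (key _ hw2)

/-- The pulled back charts read a local homeomorphism as the identity. -/
theorem pullbackChartedSpace_apply_symm (hp : IsLocalHomeomorph p) (b : B) {w : H}
    (hw : w ∈ ((hp.pullbackChartedSpace (H := H)).chartAt b).target) :
    p (((hp.pullbackChartedSpace (H := H)).chartAt b).symm w) = (chartAt H (p b)).symm w := by
  have h := congrFun (hp b).choose_spec.2 ((hp b).choose.symm ((chartAt H (p b)).symm w))
  exact h.trans ((hp b).choose.right_inv hw.2)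

theorem pullbackChartedSpace_apply (hp : IsLocalHomeomorph p) (b y : B) :
    (hp.pullbackChartedSpace (H := H)).chartAt b y = chartAt H (p b) (p y) := by
  have h := congrFun (hp b).choose_spec.2 y
  exact congrArg (chartAt H (p b)) h.symm

theorem mem_pullbackChartedSpace_target (hp : IsLocalHomeomorph p) (b : B) :
    chartAt H (p b) (p b) ∈ ((hp.pullbackChartedSpace (H := H)).chartAt b).target := by
  let : ChartedSpace H B := hp.pullbackChartedSpace
  rw [← hp.pullbackChartedSpace_apply]
  exact mem_chart_target H b

end IsLocalHomeomorph

/-! ### Holomorphy and anti-holomorphy of lifts -/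

section Holomorphic

open Filter Topology

variable {B X Y Z : Type*} [TopologicalSpace B] [TopologicalSpace X] [TopologicalSpace Y]
  [TopologicalSpace Z] [ChartedSpace ℂ X] [ChartedSpace ℂ Y] [ChartedSpace ℂ Z] {p : B → X}

theorem IsLocalHomeomorph.mdifferentiable_pullback (hp : IsLocalHomeomorph p) :
    letI : ChartedSpace ℂ B := hp.pullbackChartedSpace
    MDifferentiable 𝓘(ℂ, ℂ) 𝓘(ℂ, ℂ) p := by
  let : ChartedSpace ℂ B := hp.pullbackChartedSpace
  intro b
  rw [mdifferentiableAt_iff]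
  refine ⟨hp.continuous.continuousAt, ?_⟩
  refine DifferentiableAt.differentiableWithinAt ?_
  refine differentiableAt_id.congr_of_eventuallyEq ?_
  have ht : (chartAt ℂ b).target ∈ 𝓝 (extChartAt 𝓘(ℂ, ℂ) b b) :=
    (chartAt ℂ b).open_target.mem_nhds (mem_chart_target ℂ b)
  filter_upwards [ht] with w hw
  change chartAt ℂ (p b) (p ((chartAt ℂ b).symm w)) = w
  rw [hp.pullbackChartedSpace_apply_symm b hw]
  exact (chartAt ℂ (p b)).right_inv hw.1

/-- A continuous lift of a holomorphic map through a holomorphic local homeomorphism is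
holomorphic. -/
theorem IsLocalHomeomorph.mdifferentiable_of_comp [IsManifold 𝓘(ℂ, ℂ) ω X]
    [IsManifold 𝓘(ℂ, ℂ) ω Z] {q : Z → X} (hq : IsLocalHomeomorph q)
    (hq' : MDifferentiable 𝓘(ℂ, ℂ) 𝓘(ℂ, ℂ) q) {φ : Y → Z} (hφ : Continuous φ)
    (h : MDifferentiable 𝓘(ℂ, ℂ) 𝓘(ℂ, ℂ) (q ∘ φ)) : MDifferentiable 𝓘(ℂ, ℂ) 𝓘(ℂ, ℂ) φ := by
  have : IsManifold 𝓘(ℂ, ℂ) 1 X := IsManifold.of_le (n := ω) le_top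
  have : IsManifold 𝓘(ℂ, ℂ) 1 Z := IsManifold.of_le (n := ω) le_top
  intro y
  obtain ⟨e, hy, rfl⟩ := hq (φ y)
  let c := chartAt ℂ (φ y)
  let d := chartAt ℂ (e (φ y))
  have hcs : φ y ∈ c.source := mem_chart_source ℂ _
  have hds : e (φ y) ∈ d.source := mem_chart_source ℂ _
  have hc := mdifferentiable_chart (I := 𝓘(ℂ, ℂ)) (φ y)
  have hd := mdifferentiable_chart (I := 𝓘(ℂ, ℂ)) (e (φ y))
  -- `E` is `q` read in charts. Its inverse is holomorphic, and near `y` it recovers `φ` from the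
  -- holomorphic map `q ∘ φ`.
  let E : OpenPartialHomeomorph ℂ ℂ := c.symm ≫ₕ e ≫ₕ d
  have hE : DifferentiableOn ℂ E E.source := by
    rintro w ⟨hw1, hw2, hw3⟩
    have h1 : MDifferentiableAt 𝓘(ℂ, ℂ) 𝓘(ℂ, ℂ) (e ∘ c.symm) w :=
      (hq' _).comp w (hc.mdifferentiableAt_symm hw1)
    have h2 : MDifferentiableAt 𝓘(ℂ, ℂ) 𝓘(ℂ, ℂ) d (e (c.symm w)) := hd.mdifferentiableAt hw3
    have h3 : MDifferentiableAt 𝓘(ℂ, ℂ) 𝓘(ℂ, ℂ) (d ∘ e ∘ c.symm) w := h2.comp w h1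
    exact h3.differentiableAt.differentiableWithinAt
  have hE' := E.differentiableOn_symm hE
  have hloc : φ =ᶠ[𝓝 y] fun y' => c.symm (E.symm (d (e (φ y')))) := by
    have hsrc : (e ≫ₕ d).source ∩ c.source ∈ 𝓝 (φ y) :=
      ((e ≫ₕ d).open_source.inter c.open_source).mem_nhds ⟨⟨hy, hds⟩, hcs⟩
    filter_upwards [hφ.continuousAt hsrc] with y' hy'
    have hsym : E.symm (d (e (φ y'))) = c ((e ≫ₕ d).symm ((e ≫ₕ d) (φ y'))) := rfl
    rw [hsym, (e ≫ₕ d).left_inv hy'.1, c.left_inv hy'.2]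
  have hmem : d (e (φ y)) ∈ E.target := by
    have h1 : c (φ y) ∈ E.source := by
      refine ⟨c.map_source hcs, ?_⟩
      change c.symm (c (φ y)) ∈ (e ≫ₕ d).source
      rw [c.left_inv hcs]
      exact ⟨hy, hds⟩
    have h2 := E.map_source h1
    have h3 : E (c (φ y)) = d (e (c.symm (c (φ y)))) := rfl
    rwa [h3, c.left_inv hcs] at h2
  refine MDifferentiableAt.congr_of_eventuallyEq ?_ hloc
  have h1 : MDifferentiableAt 𝓘(ℂ, ℂ) 𝓘(ℂ, ℂ) (fun y' => d (e (φ y'))) y :=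
    (hd.mdifferentiableAt hds).comp y (h y)
  have h2 : MDifferentiableAt 𝓘(ℂ, ℂ) 𝓘(ℂ, ℂ) E.symm (d (e (φ y))) :=
    (hE'.differentiableAt (E.open_target.mem_nhds hmem)).mdifferentiableAt
  have h3 : E.symm (d (e (φ y))) ∈ c.target := (E.map_target hmem).1
  exact (hc.mdifferentiableAt_symm h3).comp y (h2.comp y h1)

/-- A continuous lift of an anti-holomorphic map is anti-holomorphic for the pulled back charts. -/
theorem IsLocalHomeomorph.antiHolomorphic_pullback (hp : IsLocalHomeomorph p) {s : X → X}
    (hs : KleinSurface.AntiHolomorphic s) {t : B → B} (ht : Continuous t)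
    (hst : ∀ b, p (t b) = s (p b)) :
    letI : ChartedSpace ℂ B := hp.pullbackChartedSpace
    KleinSurface.AntiHolomorphic t := by
  let : ChartedSpace ℂ B := hp.pullbackChartedSpace
  refine ⟨ht, fun b => ?_⟩
  obtain ⟨L, hL, hconj⟩ := hs.2 (p b)
  refine ⟨L, ?_, hconj⟩
  have hb : chartAt ℂ b b = chartAt ℂ (p b) (p b) := hp.pullbackChartedSpace_apply b b
  rw [hb]
  refine hL.congr_of_eventuallyEq ?_
  filter_upwards [(chartAt ℂ b).open_target.mem_nhds
    (hp.mem_pullbackChartedSpace_target b)] with w hw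
  rw [← hst, ← hp.pullbackChartedSpace_apply_symm b hw, ← hst]
  exact hp.pullbackChartedSpace_apply _ _

end Holomorphic

/-! ### Deck transformations and lifts of the real structure -/

namespace KleinSurface

section Deck

variable {X : Type u} [TopologicalSpace X] [ChartedSpace ℂ X] {σ : RealStructure X} {x : X}
  {U : UniversalCover x}

lemma UniversalCover.proj_surjective [ConnectedSpace X] (U : UniversalCover x) :
    Function.Surjective U.proj := by
  have : LocallyPathConnectedSpace X := ChartedSpace.locallyPathConnectedSpace ℂ X
  have : PathConnectedSpace X := pathConnectedSpace_iff_connectedSpace.2 inferInstance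
  intro y
  obtain ⟨γ⟩ := PathConnectedSpace.joined x y
  obtain ⟨Γ, hΓ, -⟩ := U.isCoveringMap.exists_path_lifts (γ : C(unitInterval, X)) U.base
    (by simp [U.proj_base])
  exact ⟨Γ 1, (congrFun hΓ 1).trans (by simp)⟩

omit [ChartedSpace ℂ X] in
lemma UniversalCover.eq_of_proj_comp_eq {B : Type*} [TopologicalSpace B] {q : B → X}
    (hq : IsCoveringMap q) {s t : U.carrier → B} (hs : Continuous s) (ht : Continuous t)
    (h : ∀ w, q (s w) = q (t w)) {z : U.carrier} (hz : s z = t z) : s = t :=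
  hq.eq_of_comp_eq hs ht (funext h) z hz

lemma UniversalCover.exists_continuousMap {B : Type*} [TopologicalSpace B] {q : B → X}
    (hq : IsCoveringMap q) {s : X → X} (hs : Continuous s) {z : U.carrier} {b : B}
    (h : q b = s (U.proj z)) :
    ∃ f : C(U.carrier, B), f z = b ∧ ∀ w, q (f w) = s (U.proj w) := by
  have := U.locallyPathConnectedSpace
  obtain ⟨f, ⟨hf, hf'⟩, -⟩ := hq.existsUnique_continuousMap_lifts
    ⟨s ∘ U.proj, hs.comp U.isCoveringMap.continuous⟩ z b h
  exact ⟨f, hf, fun w => congrFun hf' w⟩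

/-- A continuous involution of the base of a universal cover lifts to a self-homeomorphism with
any prescribed admissible value at a given point. -/
lemma UniversalCover.exists_homeomorph {s : X → X} (hs : Continuous s)
    (hi : Function.Involutive s) {z z' : U.carrier} (h : U.proj z' = s (U.proj z)) :
    ∃ f : U.carrier ≃ₜ U.carrier, f z = z' ∧ ∀ w, U.proj (f w) = s (U.proj w) := by
  obtain ⟨f, hf, hfp⟩ := UniversalCover.exists_continuousMap U.isCoveringMap hs h
  obtain ⟨g, hg, hgp⟩ := UniversalCover.exists_continuousMap U.isCoveringMap hs
    (z := z') (b := z) (by rw [h, hi])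
  -- As `s` is an involution, both composites of `f` and `g` lift `p` and fix a point, so uniqueness
  -- of lifts makes them the identity.
  have hgf : g ∘ f = id := UniversalCover.eq_of_proj_comp_eq U.isCoveringMap
    (g.continuous.comp f.continuous) continuous_id
    (fun w => by simp [hgp, hfp, hi _]) (z := z) (by simp [hf, hg])
  have hfg : f ∘ g = id := UniversalCover.eq_of_proj_comp_eq U.isCoveringMap
    (f.continuous.comp g.continuous) continuous_id
    (fun w => by simp [hgp, hfp, hi _]) (z := z') (by simp [hf, hg])
  exact ⟨⟨⟨f, g, congrFun hgf, congrFun hfg⟩, f.continuous, g.continuous⟩, hf, hfp⟩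

/-- Transitivity of the deck group on fibres: the lifting result for the involution `id`. -/
lemma exists_mem_pi1 {z z' : U.carrier} (h : U.proj z' = U.proj z) :
    ∃ g ∈ pi1 σ U, g.homeo z = z' := by
  obtain ⟨f, hf, hfp⟩ := UniversalCover.exists_homeomorph continuous_id (fun _ => rfl) h
  exact ⟨MulOpposite.op ⟨f, Or.inl hfp⟩, hfp, hf⟩

/-- Freeness of the deck action, from uniqueness of lifts. -/
lemma eq_one_of_mem_pi1 {g : RealPi1 σ U} (hg : g ∈ pi1 σ U) {z : U.carrier}
    (h : g.homeo z = z) : g = 1 := by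
  apply MulOpposite.unop_injective
  apply Subtype.ext
  apply Homeomorph.ext
  exact congrFun (UniversalCover.eq_of_proj_comp_eq U.isCoveringMap (g.homeo.continuous)
    continuous_id hg h)

lemma exists_coversSigma [ConnectedSpace X] (σ : RealStructure X) (U : UniversalCover x) :
    ∃ h : RealPi1 σ U, h.CoversSigma := by
  obtain ⟨z', hz'⟩ := U.proj_surjective (σ (U.proj U.base))
  obtain ⟨f, -, hfp⟩ := UniversalCover.exists_homeomorph σ.antiHolomorphic.1 σ.involutive hz'
  exact ⟨MulOpposite.op ⟨f, Or.inr hfp⟩, hfp⟩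

lemma RealPi1.CoversSigma.inv {g : RealPi1 σ U} (hg : g.CoversSigma) : g⁻¹.CoversSigma := by
  intro z
  have h := hg (g⁻¹.homeo z)
  have hz : g.homeo (g⁻¹.homeo z) = z := g.homeo.apply_symm_apply z
  rw [hz] at h
  rw [h]
  exact (σ.involutive _).symm

lemma RealPi1.CoversSigma.mul {f g : RealPi1 σ U} (hf : f.CoversSigma) (hg : g.CoversSigma) :
    f * g ∈ pi1 σ U := fun z =>
  (hg (f.homeo z)).trans ((congrArg σ (hf z)).trans (σ.involutive _))

lemma RealPi1.CoversSigma.mul_coversId {f g : RealPi1 σ U} (hf : f.CoversSigma)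
    (hg : g ∈ pi1 σ U) : (f * g).CoversSigma := fun z => (hg (f.homeo z)).trans (hf z)

/-- A real structure on a nonempty Riemann surface is not the identity. -/
lemma RealStructure.exists_ne [Nonempty X] (σ : RealStructure X) : ∃ y, σ y ≠ y := by
  by_contra! h
  obtain ⟨y⟩ := ‹Nonempty X›
  obtain ⟨L, hL, hconj⟩ := σ.antiHolomorphic.2 y
  have hid : HasFDerivAt (fun z : ℂ => z) L (chartAt ℂ y y) := by
    refine hL.congr_of_eventuallyEq ?_
    filter_upwards [(chartAt ℂ y).open_target.mem_nhds (mem_chart_target ℂ y)] with w hw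
    rw [h, h, (chartAt ℂ y).right_inv hw]
  have hL' : L = ContinuousLinearMap.id ℝ ℂ := hid.unique (hasFDerivAt_id _)
  -- An antilinear identity would give `I = -I`.
  have h1 := congrArg Complex.im (hconj Complex.I 1)
  subst hL'
  norm_num at h1

/-- Needed because `tauOf` tests only `CoversId`: without it, a lift of `σ` might be assigned the
identity instead of `τ`. -/
lemma RealPi1.CoversSigma.not_coversId [ConnectedSpace X] {g : RealPi1 σ U}
    (hg : g.CoversSigma) : ¬ g.CoversId := by
  intro h
  obtain ⟨y, hy⟩ := σ.exists_ne
  obtain ⟨z, rfl⟩ := U.proj_surjective y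
  exact hy ((hg z).symm.trans (h z))

end Deck

/-! ### The balanced product as a covering with involution -/

namespace BalancedProduct

variable {X : Type u} [TopologicalSpace X] [ChartedSpace ℂ X] {σ : RealStructure X} {x : X}
  {U : UniversalCover x} {F F' : Action (Type u) (RealPi1 σ U)}

lemma rho_mul (f g : RealPi1 σ U) (v : F.V) : F.ρ (f * g) v = F.ρ f (F.ρ g v) := by
  rw [map_mul]
  rfl

lemma rho_one (v : F.V) : F.ρ 1 v = v := by
  rw [map_one]
  rfl

lemma exists_rep (b : BalancedProduct F) : ∃ z v, mk F z v = b := by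
  obtain ⟨⟨z, v⟩, h⟩ := Quotient.exists_rep b
  exact ⟨z, v, h⟩

lemma mk_eq_mk_iff {z z' : U.carrier} {v v' : F.V} :
    mk F z v = mk F z' v' ↔ ∃ f ∈ pi1 σ U, z' = f⁻¹.homeo z ∧ v' = F.ρ f v := by
  refine Quotient.eq.trans ?_
  exact exists_congr fun f => and_congr_right fun _ => Prod.ext_iff

lemma mk_smul {f : RealPi1 σ U} (hf : f ∈ pi1 σ U) (z : U.carrier) (v : F.V) :
    mk F (f⁻¹.homeo z) (F.ρ f v) = mk F z v :=
  (mk_eq_mk_iff.2 ⟨f, hf, rfl, rfl⟩).symm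

lemma mk_injective (z : U.carrier) : Function.Injective (mk F z) := by
  intro v v' h
  obtain ⟨f, hf, hz, rfl⟩ := mk_eq_mk_iff.1 h
  have h1 : f⁻¹ = 1 := eq_one_of_mem_pi1 ((pi1 σ U).inv_mem hf) hz.symm
  rw [inv_eq_one.1 h1, rho_one]

variable (F) in
/-- The projection `[z, v] ↦ p z`. -/
def proj : BalancedProduct F → X :=
  Quotient.lift (fun a => U.proj a.1) (by
    rintro ⟨z, v⟩ _ ⟨f, hf, rfl⟩
    exact ((pi1 σ U).inv_mem hf z).symm)

@[simp] lemma proj_mk (z : U.carrier) (v : F.V) : proj F (mk F z v) = U.proj z := rfl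

lemma exists_mk_eq {b : BalancedProduct F} {z : U.carrier} (h : proj F b = U.proj z) :
    ∃ v, mk F z v = b := by
  obtain ⟨z', v, rfl⟩ := exists_rep b
  obtain ⟨g, hg, rfl⟩ := exists_mem_pi1 (σ := σ) (z := z') (z' := z) h.symm
  refine ⟨F.ρ g⁻¹ v, ?_⟩
  have := mk_smul (F := F) ((pi1 σ U).inv_mem hg) z' v
  rwa [inv_inv] at this

/-- With `F` discrete, `X̃ × F` is a disjoint union of copies of `X̃`, so topology on the quotient
is tested slice by slice. -/
lemma isOpen_iff {S : Set (BalancedProduct F)} :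
    IsOpen S ↔ ∀ v, IsOpen {z | mk F z v ∈ S} := by
  let _ : TopologicalSpace F.V := ⊥
  have : DiscreteTopology F.V := ⟨rfl⟩
  have hq : Topology.IsQuotientMap (Quotient.mk (balancedSetoid F)) := isQuotientMap_quotient_mk'
  refine hq.isOpen_preimage.symm.trans ?_
  constructor
  · intro h v
    exact h.preimage (Continuous.prodMk_left v)
  · intro h
    have : Quotient.mk (balancedSetoid F) ⁻¹' S = ⋃ v, {z | mk F z v ∈ S} ×ˢ {v} := by
      ext ⟨z, v⟩
      simp only [Set.mem_iUnion, Set.mem_prod, Set.mem_singleton_iff]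
      exact ⟨fun h => ⟨v, h, rfl⟩, fun ⟨_, h, hv⟩ => hv ▸ h⟩
    rw [this]
    exact isOpen_iUnion fun v => (h v).prod (isOpen_discrete _)

lemma continuous_mk (v : F.V) : Continuous fun z => mk F z v :=
  continuous_def.2 fun _ hS => isOpen_iff.1 hS v

lemma continuous_of_comp_mk {B : Type*} [TopologicalSpace B] {t : BalancedProduct F → B}
    (h : ∀ v, Continuous fun z => t (mk F z v)) : Continuous t :=
  continuous_def.2 fun _ hS => isOpen_iff.2 fun v => hS.preimage (h v)

/-- In the slice of `w`, the image of `O` pulls back to the union of the translates of `O` by those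
`f` in `π₁` with `f • w = v`. -/
lemma isOpenMap_mk (v : F.V) : IsOpenMap fun z => mk F z v := by
  intro O hO
  refine isOpen_iff.2 fun w => ?_
  have : {z | mk F z w ∈ (fun z => mk F z v) '' O} =
      ⋃ f ∈ {f | f ∈ pi1 σ U ∧ v = F.ρ f w}, f⁻¹.homeo ⁻¹' O := by
    ext z
    simp only [Set.mem_ofPred_eq, Set.mem_image, Set.mem_iUnion, Set.mem_preimage, exists_prop]
    constructor
    · rintro ⟨z', hz', h⟩
      obtain ⟨f, hf, rfl, rfl⟩ := mk_eq_mk_iff.1 h.symm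
      exact ⟨f, ⟨hf, rfl⟩, hz'⟩
    · rintro ⟨f, ⟨hf, rfl⟩, hz⟩
      exact ⟨_, hz, mk_smul hf z w⟩
  rw [this]
  exact isOpen_biUnion fun f _ => hO.preimage f⁻¹.homeo.continuous

lemma continuous_proj : Continuous (proj F) :=
  continuous_of_comp_mk fun _ => U.isCoveringMap.continuous

variable (F) in
theorem isCoveringMap_proj [ConnectedSpace X] : IsCoveringMap (proj F) := by
  let _ : TopologicalSpace F.V := ⊥
  have : DiscreteTopology F.V := ⟨rfl⟩
  intro y
  refine IsEvenlyCovered.to_isEvenlyCovered_preimage (I := F.V) ?_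
  obtain ⟨z, rfl⟩ := U.proj_surjective y
  obtain ⟨e, hz, he⟩ := U.isCoveringMap.isLocalHomeomorph z
  have hsec : ∀ w ∈ e.target, U.proj (e.symm w) = w := fun w hw => by
    rw [he]
    exact e.right_inv hw
  have hpre : IsOpen (proj F ⁻¹' e.target) := e.open_target.preimage continuous_proj
  -- The inverse trivialisation built from the local section `e.symm` of `p`: freeness of the deck
  -- action gives injectivity, transitivity gives surjectivity.
  let k : e.target × F.V → proj F ⁻¹' e.target := fun a =>
    ⟨mk F (e.symm a.1) a.2, by
      change U.proj (e.symm a.1) ∈ e.target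
      rw [hsec _ a.1.2]
      exact a.1.2⟩
  have hk : Function.Bijective k := by
    constructor
    · rintro ⟨⟨w, hw⟩, v⟩ ⟨⟨w', hw'⟩, v'⟩ h
      have h1 : mk F (e.symm w) v = mk F (e.symm w') v' := congrArg Subtype.val h
      have h2 := congrArg (proj F) h1
      simp only [proj_mk, hsec _ hw, hsec _ hw'] at h2
      subst h2
      rw [mk_injective _ h1]
    · rintro ⟨b, hb⟩
      obtain ⟨v, hv⟩ := exists_mk_eq (b := b) (z := e.symm (proj F b)) (hsec _ hb).symm
      exact ⟨(⟨proj F b, hb⟩, v), Subtype.ext hv⟩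
  have hkc : Continuous k := by
    rw [continuous_prod_of_discrete_right]
    intro v
    exact ((continuous_mk v).comp e.continuousOn_symm.domRestrict).subtype_mk _
  have hko : IsOpenMap k := by
    rw [isOpenMap_prod_of_discrete_right]
    intro v
    refine IsOpenMap.subtype_mk ((isOpenMap_mk v).comp (f := fun w : e.target => e.symm w) ?_) _
    intro S hS
    have h1 : IsOpen (Subtype.val '' S) := e.open_target.isOpenMap_subtype_val S hS
    have h2 := e.isOpen_image_symm_of_subset_target h1 (by simp)
    rwa [Set.image_image] at h2
  refine ⟨inferInstance, e.target, ?_, e.open_target, hpre,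
    ((Equiv.ofBijective k hk).toHomeomorphOfContinuousOpen hkc hko).symm, ?_⟩
  · rw [he]
    exact e.map_source hz
  · intro b
    obtain ⟨a, rfl⟩ := hk.2 b
    change ((Equiv.ofBijective k hk).symm (Equiv.ofBijective k hk a)).1.1 = _
    rw [Equiv.symm_apply_apply]
    exact (hsec _ a.1.2).symm

/-- The element `h' * h⁻¹` lies in `π₁` and carries the first representative to the second. -/
lemma mk_act_eq {h h' : RealPi1 σ U} (hh : h.CoversSigma) (hh' : h'.CoversSigma)
    (z : U.carrier) (v : F.V) :
    mk F (h⁻¹.homeo z) (F.ρ h v) = mk F (h'⁻¹.homeo z) (F.ρ h' v) := by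
  have := mk_smul (F := F) (hh'.mul hh.inv) (h⁻¹.homeo z) (F.ρ h v)
  rw [← this, ← rho_mul, inv_mul_cancel_right]
  congr 1
  change (h⁻¹ * (h' * h⁻¹)⁻¹).homeo z = _
  rw [mul_inv_rev, inv_inv, inv_mul_cancel_left]

variable (F) in
/-- The involution `[z, v] ↦ [z · h⁻¹, h • v]`. -/
def act (h : RealPi1 σ U) (hh : h.CoversSigma) : BalancedProduct F → BalancedProduct F :=
  Quotient.lift (fun a => mk F (h⁻¹.homeo a.1) (F.ρ h a.2)) (by
    rintro ⟨z, v⟩ _ ⟨f, hf, rfl⟩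
    change _ = mk F ((f⁻¹ * h⁻¹).homeo z) (F.ρ h (F.ρ f v))
    rw [← rho_mul, ← mul_inv_rev]
    exact mk_act_eq hh (hh.mul_coversId hf) z v)

@[simp] lemma act_mk (h : RealPi1 σ U) (hh : h.CoversSigma) (z : U.carrier) (v : F.V) :
    act F h hh (mk F z v) = mk F (h⁻¹.homeo z) (F.ρ h v) := rfl

lemma continuous_act (h : RealPi1 σ U) (hh : h.CoversSigma) : Continuous (act F h hh) :=
  continuous_of_comp_mk fun v => (continuous_mk (F.ρ h v)).comp h⁻¹.homeo.continuous

lemma act_involutive (h : RealPi1 σ U) (hh : h.CoversSigma) :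
    Function.Involutive (act F h hh) := by
  intro b
  obtain ⟨z, v, rfl⟩ := exists_rep b
  rw [act_mk, act_mk, ← rho_mul]
  change mk F ((h⁻¹ * h⁻¹).homeo z) _ = _
  rw [← mul_inv_rev]
  exact mk_smul (hh.mul hh) z v

lemma proj_act (h : RealPi1 σ U) (hh : h.CoversSigma) (b : BalancedProduct F) :
    proj F (act F h hh b) = σ (proj F b) := by
  obtain ⟨z, v, rfl⟩ := exists_rep b
  exact hh.inv z

/-- The map `[z, v] ↦ [z, g v]` induced by a map of `π₁^ℝ((X, σ); x)`-sets. -/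
def map (g : F ⟶ F') : BalancedProduct F → BalancedProduct F' :=
  Quotient.lift (fun a => mk F' a.1 (g.hom a.2)) (by
    rintro ⟨z, v⟩ _ ⟨f, hf, rfl⟩
    change _ = mk F' (f⁻¹.homeo z) (g.hom (F.ρ f v))
    have : g.hom (F.ρ f v) = F'.ρ f (g.hom v) := ConcreteCategory.congr_hom (g.comm f) v
    rw [this]
    exact (mk_smul hf z _).symm)

@[simp] lemma map_mk (g : F ⟶ F') (z : U.carrier) (v : F.V) :
    map g (mk F z v) = mk F' z (g.hom v) := rfl

lemma continuous_map (g : F ⟶ F') : Continuous (map g) :=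
  continuous_of_comp_mk fun v => continuous_mk (g.hom v)

end BalancedProduct

end KleinSurface

namespace KleinSurface

variable {X : Type u} [TopologicalSpace X] [ChartedSpace ℂ X] {σ : RealStructure X} {x : X}
  {U : UniversalCover x}

/-! ### Real covers, the two functors and the equivalence -/

namespace RealCover

/-- A homomorphism of real covers is a continuous map over `X` commuting with the real
structures. -/
def Hom.ofContinuous [IsManifold 𝓘(ℂ, ℂ) ω X] {Y Z : RealCover σ} (f : Y.carrier → Z.carrier)
    (hf : Continuous f) (hτ : ∀ y, f (Y.tau y) = Z.tau (f y))
    (hp : ∀ y, Z.proj (f y) = Y.proj y) : Y ⟶ Z where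
  toFun := f
  holomorphic := Z.isCoveringMap.isLocalHomeomorph.mdifferentiable_of_comp Z.holomorphic hf (by
    rw [show Z.proj ∘ f = Y.proj from funext hp]
    exact Y.holomorphic)
  map_tau := hτ
  proj_map := hp

/-- A bijective homomorphism of real covers is an isomorphism. -/
noncomputable def isoOfBijective [IsManifold 𝓘(ℂ, ℂ) ω X] {Y Z : RealCover σ} (φ : Y ⟶ Z)
    (h : Function.Bijective (Hom.toFun φ)) : Y ≅ Z :=
  have hφ : IsLocalHomeomorph (Hom.toFun φ) := by
    refine IsLocalHomeomorph.of_comp (g := Z.proj) ?_ Z.isCoveringMap.isLocalHomeomorph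
      (Hom.holomorphic φ).continuous
    rw [show Z.proj ∘ Hom.toFun φ = Y.proj from funext (Hom.proj_map φ)]
    exact Y.isCoveringMap.isLocalHomeomorph
  let e := Equiv.ofBijective (Hom.toFun φ) h
  have he : ∀ z, Hom.toFun φ (e.symm z) = z := e.apply_symm_apply
  { hom := φ
    inv := Hom.ofContinuous e.symm (hφ.toHomeomorphOfBijective h).symm.continuous
      (fun z => h.1 (by rw [he, Hom.map_tau, he]))
      (fun z => by rw [← Hom.proj_map φ, he])
    hom_inv_id := Hom.ext (funext e.symm_apply_apply)
    inv_hom_id := Hom.ext (funext he) }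

lemma tauOf_of_mem (Y : RealCover σ) {g : RealPi1 σ U} (hg : g ∈ pi1 σ U) (y : Y.carrier) :
    Y.tauOf g y = y :=
  congrFun (if_pos hg) y

lemma tauOf_of_coversSigma [ConnectedSpace X] (Y : RealCover σ) {g : RealPi1 σ U}
    (hg : g.CoversSigma) (y : Y.carrier) : Y.tauOf g y = Y.tau y :=
  congrFun (if_neg hg.not_coversId) y

/-- The lift at `g • y` is `τ_g ∘ t_y ∘ g`. -/
lemma lift_smul (Y : RealCover σ) (g : RealPi1 σ U) (y : Y.Fibre x) (z : U.carrier) :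
    Y.lift U (g • y) z = Y.tauOf g (Y.lift U y (g.homeo z)) := by
  symm
  refine congrFun (Y.eq_lift U (g • y) (t := fun z => Y.tauOf g (Y.lift U y (g.homeo z)))
    ?_ rfl ?_) z
  · exact (Y.continuous_tauOf g).comp ((Y.lift U y).continuous.comp g.homeo.continuous)
  · exact fun z => Y.proj_tauOf g (Y.proj_lift U y _)

/-- For `g` in `π₁` this makes `[z, y] ↦ t_y z` well defined; for `g` covering `σ` it makes that map
commute with the real structures. -/
lemma lift_smul_inv (Y : RealCover σ) (g : RealPi1 σ U) (y : Y.Fibre x) (z : U.carrier) :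
    Y.lift U (g • y) (g⁻¹.homeo z) = Y.tauOf g (Y.lift U y z) := by
  rw [lift_smul]
  congr 2
  exact g.homeo.apply_symm_apply z

lemma lift_injective (Y : RealCover σ) (z : U.carrier) :
    Function.Injective fun y : Y.Fibre x => Y.lift U y z := by
  intro y y' h
  have hl := UniversalCover.eq_of_proj_comp_eq Y.isCoveringMap (Y.lift U y).continuous
    (Y.lift U y').continuous (fun w => by rw [Y.proj_lift, Y.proj_lift]) h
  exact Subtype.ext (by rw [← Y.lift_base U y, ← Y.lift_base U y', hl])

lemma lift_fibreMap {Y Z : RealCover σ} (φ : Y ⟶ Z) (y : Y.Fibre x) (z : U.carrier) :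
    Z.lift U (Hom.fibreMap φ x y) z = Hom.toFun φ (Y.lift U y z) := by
  symm
  refine congrFun (Z.eq_lift U _ (t := fun z => Hom.toFun φ (Y.lift U y z)) ?_ ?_ ?_) z
  · exact (Hom.holomorphic φ).continuous.comp (Y.lift U y).continuous
  · exact congrArg _ (Y.lift_base U y)
  · exact fun z => (Hom.proj_map φ _).trans (Y.proj_lift U y z)

/-- The map `X̃ ×_{π₁(X; x)} Y_x ⟶ Y`, `[z, y] ↦ t_y z`. -/
noncomputable def evalMap (U : UniversalCover x) (Y : RealCover σ) :
    BalancedProduct ((fibreFunctor σ U).obj Y) → Y.carrier :=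
  Quotient.lift (fun a => Y.lift U a.2 a.1) (by
    rintro ⟨z, y⟩ _ ⟨f, hf, rfl⟩
    exact ((Y.lift_smul_inv f y z).trans (Y.tauOf_of_mem hf _)).symm)

variable [T2Space X] [ConnectedSpace X] [IsManifold 𝓘(ℂ, ℂ) ω X]

/-- The real cover `X̃ ×_{π₁(X; x)} F` of `(X, σ)`. -/
noncomputable def ofAction (F : Action (Type u) (RealPi1 σ U)) : RealCover σ :=
  have hp := BalancedProduct.isCoveringMap_proj F
  have hloc := hp.isLocalHomeomorph
  letI : ChartedSpace ℂ (BalancedProduct F) := hloc.pullbackChartedSpace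
  have hσ := (exists_coversSigma σ U).choose_spec
  { carrier := BalancedProduct F
    t2Space := hp.isSeparatedMap.t2Space hp.continuous
    isManifold :=
      have := hloc.pullbackChartedSpace_hasGroupoid (contDiffGroupoid ω 𝓘(ℂ, ℂ))
      IsManifold.mk' _ _ _
    tau :=
      { toFun := BalancedProduct.act F _ hσ
        antiHolomorphic := hloc.antiHolomorphic_pullback σ.antiHolomorphic
          (BalancedProduct.continuous_act _ hσ) (BalancedProduct.proj_act _ hσ)
        involutive := BalancedProduct.act_involutive _ hσ }
    proj := BalancedProduct.proj F
    holomorphic := hloc.mdifferentiable_pullback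
    isCoveringMap := hp
    proj_tau := BalancedProduct.proj_act _ hσ }

lemma ofAction_tau_mk (F : Action (Type u) (RealPi1 σ U)) {h : RealPi1 σ U} (hh : h.CoversSigma)
    (z : U.carrier) (v : F.V) : (ofAction F).tau (BalancedProduct.mk F z v) =
      BalancedProduct.mk F (h⁻¹.homeo z) (F.ρ h v) :=
  BalancedProduct.mk_act_eq (exists_coversSigma σ U).choose_spec hh z v

/-- The homomorphism `[z, v] ↦ [z, g v]`. -/
noncomputable def ofActionMap {F F' : Action (Type u) (RealPi1 σ U)} (g : F ⟶ F') :
    ofAction F ⟶ ofAction F' :=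
  Hom.ofContinuous (BalancedProduct.map g) (BalancedProduct.continuous_map g)
    (by
      intro b
      obtain ⟨z, v, rfl⟩ := BalancedProduct.exists_rep b
      obtain ⟨h, hh⟩ := exists_coversSigma σ U
      have hg : g.hom (F.ρ h v) = F'.ρ h (g.hom v) := ConcreteCategory.congr_hom (g.comm h) v
      rw [ofAction_tau_mk F hh, BalancedProduct.map_mk, BalancedProduct.map_mk,
        ofAction_tau_mk F' hh, hg])
    (by
      intro b
      obtain ⟨z, v, rfl⟩ := BalancedProduct.exists_rep b
      rfl)

variable (σ U) in
/-- The functor `F ↦ X̃ ×_{π₁(X; x)} F`. -/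
noncomputable def ofActionFunctor : Action (Type u) (RealPi1 σ U) ⥤ RealCover σ where
  obj F := ofAction F
  map g := ofActionMap g
  map_id F := by
    refine Hom.ext (funext fun b => ?_)
    obtain ⟨z, v, rfl⟩ := BalancedProduct.exists_rep b
    rfl
  map_comp f g := by
    refine Hom.ext (funext fun b => ?_)
    obtain ⟨z, v, rfl⟩ := BalancedProduct.exists_rep b
    rfl

/-- The point `[x̃, v]` of the fibre at `x`. -/
noncomputable def fibrePoint (F : Action (Type u) (RealPi1 σ U)) (v : F.V) :
    (ofAction F).Fibre x :=
  ⟨BalancedProduct.mk F U.base v, U.proj_base⟩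

lemma fibrePoint_bijective (F : Action (Type u) (RealPi1 σ U)) :
    Function.Bijective (fibrePoint F) := by
  refine ⟨fun v w h => BalancedProduct.mk_injective _ (congrArg Subtype.val h), ?_⟩
  rintro ⟨b, hb⟩
  obtain ⟨v, hv⟩ := BalancedProduct.exists_mk_eq (b := b) (z := U.base) (hb.trans U.proj_base.symm)
  exact ⟨v, Subtype.ext hv⟩

lemma lift_fibrePoint (F : Action (Type u) (RealPi1 σ U)) (v : F.V) (z : U.carrier) :
    (ofAction F).lift U (fibrePoint F v) z = BalancedProduct.mk F z v :=
  (congrFun ((ofAction F).eq_lift U (fibrePoint F v) (BalancedProduct.continuous_mk v) rfl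
    fun _ => rfl) z).symm

/-- The lift at `[x̃, v]` is `z ↦ [z, v]`, so `g` sends this point to `τ_g [x̃ · g, v] = [x̃ · g ·
g⁻¹, g • v]`. -/
lemma fibrePoint_smul (F : Action (Type u) (RealPi1 σ U)) (g : RealPi1 σ U) (v : F.V) :
    fibrePoint F (F.ρ g v) = g • fibrePoint F v := by
  apply Subtype.ext
  change _ = (ofAction F).tauOf g ((ofAction F).lift U (fibrePoint F v) (g.homeo U.base))
  rw [lift_fibrePoint]
  have hz : g⁻¹.homeo (g.homeo U.base) = U.base := g.homeo.symm_apply_apply _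
  rcases g.coversId_or with hg | hg
  · refine Eq.trans ?_ (tauOf_of_mem (ofAction F) hg _).symm
    have := BalancedProduct.mk_smul (F := F) hg (g.homeo U.base) v
    rwa [hz] at this
  · refine Eq.trans ?_ (((ofAction F).tauOf_of_coversSigma hg _).trans
      (ofAction_tau_mk F hg _ _)).symm
    rw [hz]
    rfl

/-- The isomorphism `F ≅ (X̃ ×_{π₁(X; x)} F)_x`, `v ↦ [x̃, v]`. -/
noncomputable def counitIso (F : Action (Type u) (RealPi1 σ U)) :
    F ≅ (fibreFunctor σ U).obj (ofAction F) :=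
  Action.mkIso (Equiv.ofBijective _ (fibrePoint_bijective F)).toIso fun g => by
    ext v
    exact fibrePoint_smul F g v

/-- The homomorphism of real covers `X̃ ×_{π₁(X; x)} Y_x ⟶ Y`, `[z, y] ↦ t_y z`. -/
noncomputable def evalHom (U : UniversalCover x) (Y : RealCover σ) :
    ofAction ((fibreFunctor σ U).obj Y) ⟶ Y :=
  Hom.ofContinuous (evalMap U Y)
    (BalancedProduct.continuous_of_comp_mk fun y => (Y.lift U y).continuous)
    (by
      intro b
      obtain ⟨z, y, rfl⟩ := BalancedProduct.exists_rep b
      obtain ⟨h, hh⟩ := exists_coversSigma σ U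
      rw [ofAction_tau_mk _ hh]
      exact (Y.lift_smul_inv h y z).trans (Y.tauOf_of_coversSigma hh _))
    (by
      intro b
      obtain ⟨z, y, rfl⟩ := BalancedProduct.exists_rep b
      exact Y.proj_lift U y z)

/-- Injectivity: points with equal image can be written with the same `z`, and one value determines
a lift. Surjectivity: lift `p` to `Y` through the given point over `p z`; the result is `t_y`, with
`y` its value at `x̃`. -/
lemma evalMap_bijective (U : UniversalCover x) (Y : RealCover σ) :
    Function.Bijective (evalMap U Y) := by
  have hproj : ∀ b, Y.proj (evalMap U Y b) = BalancedProduct.proj _ b :=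
    Hom.proj_map (evalHom U Y)
  constructor
  · intro a b h
    obtain ⟨z, y, rfl⟩ := BalancedProduct.exists_rep a
    have hb : BalancedProduct.proj _ b = U.proj z := by
      rw [← hproj b, ← h, hproj, BalancedProduct.proj_mk]
    obtain ⟨y', rfl⟩ := BalancedProduct.exists_mk_eq hb
    change Y.lift U y z = Y.lift U y' z at h
    have hy : y = y' := Y.lift_injective z h
    rw [hy]
  · intro b
    obtain ⟨z, hz⟩ := U.proj_surjective (Y.proj b)
    obtain ⟨t, htz, ht⟩ := UniversalCover.exists_continuousMap (U := U) Y.isCoveringMap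
      (s := id) continuous_id (z := z) (b := b) hz.symm
    let y : Y.Fibre x := ⟨t U.base, (ht U.base).trans U.proj_base⟩
    refine ⟨BalancedProduct.mk ((fibreFunctor σ U).obj Y) z y, ?_⟩
    exact (congrFun (Y.eq_lift U y t.continuous rfl ht) z).symm.trans htz

variable (σ U) in
/-- The fibre functor is an equivalence with quasi-inverse `F ↦ X̃ ×_{π₁(X; x)} F`. -/
noncomputable def fibreEquivalence : RealCover σ ≌ Action (Type u) (RealPi1 σ U) :=
  CategoryTheory.Equivalence.mk (fibreFunctor σ U) (ofActionFunctor σ U)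
    (NatIso.ofComponents (F := fibreFunctor σ U ⋙ ofActionFunctor σ U) (G := 𝟭 _)
      (fun Y => isoOfBijective (evalHom U Y) (evalMap_bijective U Y)) (fun {Y Z} φ => by
        refine Hom.ext (funext fun b => ?_)
        obtain ⟨z, y, rfl⟩ := BalancedProduct.exists_rep b
        exact lift_fibreMap φ y z)).symm
    (NatIso.ofComponents (F := 𝟭 _) (G := ofActionFunctor σ U ⋙ fibreFunctor σ U)
      (fun F => counitIso F) (fun {F F'} g => by
        ext v
        rfl)).symm

end RealCover

end KleinSurface

theorem mainTheorem2 {X : Type u} [TopologicalSpace X] [T2Space X] [ConnectedSpace X]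
    [ChartedSpace ℂ X] [IsManifold 𝓘(ℂ, ℂ) ω X] (σ : KleinSurface.RealStructure X) (x : X)
    (U : KleinSurface.UniversalCover x) :
    (∃ h : KleinSurface.RealPi1 σ U, h.CoversSigma) ∧
    ∃ e : KleinSurface.RealCover σ ≌ Action (Type u) (KleinSurface.RealPi1 σ U),
      e.functor = KleinSurface.fibreFunctor σ U ∧
      ∃ Θ : ∀ F : Action (Type u) (KleinSurface.RealPi1 σ U),
          KleinSurface.BalancedProduct F ≃ₜ (e.inverse.obj F).carrier,
        (∀ (F : Action (Type u) (KleinSurface.RealPi1 σ U)) (z : U.carrier) (v : F.V),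
          (e.inverse.obj F).proj (Θ F (KleinSurface.BalancedProduct.mk F z v)) = U.proj z) ∧
        (∀ (F : Action (Type u) (KleinSurface.RealPi1 σ U)) (h : KleinSurface.RealPi1 σ U),
          h.CoversSigma → ∀ (z : U.carrier) (v : F.V),
          (e.inverse.obj F).tau (Θ F (KleinSurface.BalancedProduct.mk F z v)) =
            Θ F (KleinSurface.BalancedProduct.mk F (h⁻¹.homeo z) (F.ρ h v))) ∧
        (∀ (F F' : Action (Type u) (KleinSurface.RealPi1 σ U)) (g : F ⟶ F') (z : U.carrier)
          (v : F.V),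
          (e.inverse.map g).toFun (Θ F (KleinSurface.BalancedProduct.mk F z v)) =
            Θ F' (KleinSurface.BalancedProduct.mk F' z (g.hom v))) :=
  -- The inverse functor has `BalancedProduct F` itself as underlying space, so each `Θ F` is the
  -- identity.
  ⟨KleinSurface.exists_coversSigma σ U, KleinSurface.RealCover.fibreEquivalence σ U, rfl,
    fun F => Homeomorph.refl (KleinSurface.BalancedProduct F), fun _ _ _ => rfl,
    fun F _ hh z v => KleinSurface.RealCover.ofAction_tau_mk F hh z v, fun _ _ _ _ _ => rfl⟩
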